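/- Fix $T>0$ and $\beta\in[0,1]$, and let $p$ be the unit-energy root-raised-cosine pulse with symbol period $T$ and roll-off factor $\beta$, i.e. the inverse Fourier transform $p(t)=\int_{\mathbb R}\sqrt{G(f)}\,e^{2\pi i f t}\,df$, where $G(f)=T$ for $|f|\le\frac{1-\beta}{2T}$, $G(f)=\frac T2\left(1+\cos\left(\frac{\pi T}{\beta}\left(|f|-\frac{1-\beta}{2T}\right)\right)\right)$ for $\frac{1-\beta}{2T}<|f|\le\frac{1+\beta}{2T}$, and $G(f)=0$ otherwise. For every acceleration factor $\delta\in(0,1]$ let $P_k=P_k(\delta)$ be the transmit power of the $k$-th antenna, and assume that the received SNR is fixed: $P_k(\delta)\,\delta=c$ for a constant $c>0$ that does not depend on $\delta$. Let $a_k[m]$, $m\in\mathbb Z$, be i.i.d. QPSK symbols of energy $P_k\delta T$, i.e. the real and the imaginary part of each symbol are independent and uniform on $\{\pm\sqrt{P_k\delta T/2}\}$. For $M\in\mathbb N$ put $$x_k^{(M)}(t)=\sum_{m=-M}^{M}a_k[m]\,p(t-m\delta T),$$ and for a random signal $x$ define the time-averaged CCDF of the instantaneous power by $$\bar{\mathcal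 C}(\gamma)=\frac1{\delta T}\int_0^{\delta T}\Pr\left[|x(t)|^2\ge\gamma\right]dt .$$ Then the time-averaged CCDF tends to $1$ as $\delta\to0$, provided that the number $N=2M+1$ of symbols is large, in both of the following senses. 1. (Large finite $N$.) For every $\gamma\in\mathbb R$, the time-averaged CCDF of $x_k^{(M)}$ at level $\gamma$ tends to $1$ as $\delta\to0^+$ and $M\to\infty$ jointly: for every $\varepsilon>0$ there are $M_0$ and $\delta_0>0$ such that it differs from $1$ by less than $\varepsilon$ for all $M\ge M_0$ and all $0<\delta<\delta_0$. 2. (Unlimited symbol stream.) For every $\delta\in(0,1]$ and every $t\in\mathbb R$ the limit $x_k(t)=\lim_{M\to\infty}x_k^{(M)}(t)$ exists almost surely, and for every $\gamma\in\mathbb R$ the time-averaged CCDF of $x_k$ satisfies $\lim_{\delta\to0^+}\bar{\mathcal C}(\gamma)=1$. -/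

import Mathlib

open MeasureTheory ProbabilityTheory Filter Topology
open scoped FourierTransform

noncomputable section

/-- The raised-cosine spectrum `G(f)` with roll-off factor `β ∈ [0, 1]` and symbol period `T`.
It is even, nonnegative, supported in `|f| ≤ (1 + β) / (2 T)`, and has total integral `1`.
For `β = 0` the middle branch is empty. -/
def raisedCosineSpectrum (β T f : ℝ) : ℝ :=
  if |f| ≤ (1 - β) / (2 * T) then T
  else if |f| ≤ (1 + β) / (2 * T) then
    T / 2 * (1 + Real.cos (Real.pi * T / β * (|f| - (1 - β) / (2 * T))))
  else 0

/-- The unit-energy root-raised-cosine (RRC) pulse: the inverse Fourier transform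
`p(t) = ∫ √G(f) exp(2 π i f t) df` of the square root of the raised-cosine spectrum. -/
def rrcPulse (β T : ℝ) : ℝ → ℂ :=
  𝓕⁻ (fun f : ℝ => ((Real.sqrt (raisedCosineSpectrum β T f) : ℝ) : ℂ))

/-- `a[m]`, `m ∈ ℤ`, are i.i.d. QPSK symbols of energy `E` under the probability measure `μ`: they
are independent, and the real and the imaginary part of each are independent of each other and
uniformly distributed on `{+√(E/2), -√(E/2)}`. -/
structure IsIIDQPSK {Ω : Type*} [MeasurableSpace Ω] (μ : Measure Ω) (a : ℤ → Ω → ℂ) (E : ℝ) :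
    Prop where
  measurable : ∀ m, Measurable (a m)
  iIndep : iIndepFun a μ
  indep_re_im : ∀ m, IndepFun (fun ω => (a m ω).re) (fun ω => (a m ω).im) μ
  map_re : ∀ m, μ.map (fun ω => (a m ω).re) =
    (2⁻¹ : ENNReal) • Measure.dirac (Real.sqrt (E / 2)) +
      (2⁻¹ : ENNReal) • Measure.dirac (-Real.sqrt (E / 2))
  map_im : ∀ m, μ.map (fun ω => (a m ω).im) =
    (2⁻¹ : ENNReal) • Measure.dirac (Real.sqrt (E / 2)) +
      (2⁻¹ : ENNReal) • Measure.dirac (-Real.sqrt (E / 2))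

/-- The transmitted signal `x(t) = ∑_{m=-M}^{M} a[m] p(t - m τ)` made of `N = 2 M + 1` symbols, sent
every `τ` seconds. -/
def ftnSignal {Ω : Type*} (p : ℝ → ℂ) (a : ℤ → Ω → ℂ) (τ : ℝ) (M : ℕ) (t : ℝ) (ω : Ω) : ℂ :=
  ∑ m ∈ Finset.Icc (-(M : ℤ)) (M : ℤ), a m ω * p (t - (m : ℝ) * τ)

/-- The signal `x(t) = ∑_{m=-∞}^{∞} a[m] p(t - m τ)` of the unlimited symbol stream, as the limit of
its symmetric partial sums. -/
def ftnSignalInf {Ω : Type*} (p : ℝ → ℂ) (a : ℤ → Ω → ℂ) (τ : ℝ) (t : ℝ) (ω : Ω) : ℂ :=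
  limUnder atTop (fun M : ℕ => ftnSignal p a τ M t ω)

/-- The CCDF `Pr[|x(t)|² ≥ γ]` of the instantaneous power of the random signal `x` at time `t`. -/
def powerCCDF {Ω : Type*} [MeasurableSpace Ω] (μ : Measure Ω) (x : ℝ → Ω → ℂ) (γ t : ℝ) : ℝ :=
  μ.real {ω | γ ≤ ‖x t ω‖ ^ 2}

/-- The average of the CCDF of the instantaneous power over the time period `[0, τ]`. -/
def avgPowerCCDF {Ω : Type*} [MeasurableSpace Ω] (μ : Measure Ω) (x : ℝ → Ω → ℂ) (τ γ : ℝ) : ℝ :=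
  1 / τ * ∫ t in (0 : ℝ)..τ, powerCCDF μ x γ t

end

/-!
The signal is a sum of independent symbols of fixed energy `c T`, weighted by samples of a
continuous pulse at spacing `δ T`. As `δ → 0`, more and more symbols see a weight close to `p 0 > 0`,
so the signal spreads out over ever larger scales and is rarely of bounded power.

Quantitatively, the pulse is real because its spectrum is even (`rrcPulse_im`), so the real part of
the signal is a sum `X = ∑ ± A vₘ` of independent signs with `A = √(c T / 2)` and `vₘ = p (t - m δ T)`.
Markov's inequality gives `Pr[X² < γ] ≤ exp (γ / 2) 𝔼 exp (-X² / 2)`, and since `exp (-x² / 2)` is the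
characteristic function of the standard Gaussian, Fubini's theorem turns the expectation into the
Gaussian average of the characteristic function of `X`
(`integral_exp_neg_sq_le_integral_norm_charFun`). That function is the product of `cos (A vₘ ξ)`, all
factors of modulus at most one, so any `n` of the symbols give an upper bound `cosAverage`
(`integral_exp_neg_sq_sum_le_cosAverage`). Fix `n`: as `δ → 0` the weights of the symbols
`0, …, n - 1` tend to `p 0` uniformly in `t ∈ [0, δ T]`, and the bound tends to the Gaussian average of
`|cos (A p(0) ξ)| ^ n`, which is small for `n` large (`exists_cosAverage_lt`). The bound is uniform in
the number `2 M + 1` of symbols once `M ≥ n`, so it passes to the unlimited stream.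

The unlimited stream converges almost surely by Kolmogorov's one-series theorem
(`ae_exists_tendsto_sum_of_summable_variance`): the samples `p (t - m δ T)` are square-summable,
because they are sums of Fourier coefficients of two square-integrable functions
(`summable_sq_rrcPulse`).
-/

/-! ### The root-raised-cosine pulse -/

lemma raisedCosineSpectrum_nonneg (β : ℝ) {T : ℝ} (hT : 0 < T) (f : ℝ) :
    0 ≤ raisedCosineSpectrum β T f := by
  unfold raisedCosineSpectrum
  split_ifs
  · exact hT.le
  · have := Real.neg_one_le_cos (Real.pi * T / β * (|f| - (1 - β) / (2 * T)))
    exact mul_nonneg (by positivity) (by linarith)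
  · exact le_rfl

lemma raisedCosineSpectrum_le (β : ℝ) {T : ℝ} (hT : 0 < T) (f : ℝ) :
    raisedCosineSpectrum β T f ≤ T := by
  unfold raisedCosineSpectrum
  split_ifs
  · exact le_rfl
  · have := Real.cos_le_one (Real.pi * T / β * (|f| - (1 - β) / (2 * T)))
    nlinarith
  · exact hT.le

lemma raisedCosineSpectrum_neg (β T f : ℝ) :
    raisedCosineSpectrum β T (-f) = raisedCosineSpectrum β T f := by
  simp [raisedCosineSpectrum]

lemma raisedCosineSpectrum_pos {β T f : ℝ} (hβ₀ : 0 ≤ β) (hT : 0 < T) (hf : |f| < 1 / (2 * T)) :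
    0 < raisedCosineSpectrum β T f := by
  unfold raisedCosineSpectrum
  split_ifs with h₁ h₂
  · exact hT
  · have hlow : 0 < |f| - (1 - β) / (2 * T) := by linarith
    have hup : |f| - (1 - β) / (2 * T) < β / (2 * T) := by
      have : 1 / (2 * T) - (1 - β) / (2 * T) = β / (2 * T) := by ring
      linarith
    have hβ : 0 < β := by
      have := (div_pos_iff_of_pos_right (by positivity : 0 < 2 * T)).1 (hlow.trans hup)
      exact this
    have hθ : Real.pi * T / β * (|f| - (1 - β) / (2 * T)) < Real.pi / 2 := by
      calc Real.pi * T / β * (|f| - (1 - β) / (2 * T)) < Real.pi * T / β * (β / (2 * T)) := by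
            gcongr
        _ = Real.pi / 2 := by field_simp
    have hθ₀ : 0 < Real.pi * T / β * (|f| - (1 - β) / (2 * T)) := by positivity
    have := Real.cos_pos_of_mem_Ioo (x := Real.pi * T / β * (|f| - (1 - β) / (2 * T)))
      ⟨by linarith [Real.pi_pos], hθ⟩
    positivity
  · refine absurd (hf.le.trans ?_) h₂
    gcongr
    linarith

lemma raisedCosineSpectrum_eq_zero {β T f : ℝ} (hβ₀ : 0 ≤ β) (hβ₁ : β ≤ 1) (hT : 0 < T)
    (hf : 1 / T < |f|) : raisedCosineSpectrum β T f = 0 := by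
  have h : (1 + β) / (2 * T) ≤ 1 / T := by
    rw [div_le_div_iff₀ (by positivity) hT]
    nlinarith
  have h' : (1 - β) / (2 * T) ≤ (1 + β) / (2 * T) := by gcongr; linarith
  unfold raisedCosineSpectrum
  rw [if_neg (by linarith), if_neg (by linarith)]

lemma measurable_raisedCosineSpectrum (β T : ℝ) : Measurable (raisedCosineSpectrum β T) := by
  unfold raisedCosineSpectrum
  refine Measurable.ite (measurableSet_le (by fun_prop) (by fun_prop)) measurable_const
    (Measurable.ite (measurableSet_le (by fun_prop) (by fun_prop)) (by fun_prop) measurable_const)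

lemma sqrt_raisedCosineSpectrum_eq_zero {β T : ℝ} (hβ₀ : 0 ≤ β) (hβ₁ : β ≤ 1) (hT : 0 < T)
    {L : ℝ} (hL : 1 / T ≤ L) (f : ℝ) (hf : f ∉ Set.Icc (-L) L) :
    Real.sqrt (raisedCosineSpectrum β T f) = 0 := by
  rw [raisedCosineSpectrum_eq_zero hβ₀ hβ₁ hT, Real.sqrt_zero]
  by_contra! h
  exact hf (abs_le.1 (h.trans hL))

lemma integrable_sqrt_raisedCosineSpectrum {β T : ℝ} (hβ₀ : 0 ≤ β) (hβ₁ : β ≤ 1) (hT : 0 < T) :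
    Integrable (fun f => Real.sqrt (raisedCosineSpectrum β T f)) := by
  have h : IntegrableOn (fun f => Real.sqrt (raisedCosineSpectrum β T f))
      (Set.Icc (-(1 / T)) (1 / T)) := by
    refine Measure.integrableOn_of_bounded (M := Real.sqrt T) (by simp)
      (measurable_raisedCosineSpectrum β T).sqrt.aestronglyMeasurable (ae_of_all _ fun f => ?_)
    rw [Real.norm_of_nonneg (Real.sqrt_nonneg _)]
    exact Real.sqrt_le_sqrt (raisedCosineSpectrum_le β hT f)
  exact h.integrable_of_forall_notMem_eq_zero
    (sqrt_raisedCosineSpectrum_eq_zero hβ₀ hβ₁ hT le_rfl)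

lemma rrcPulse_eq_integral (β T t : ℝ) :
    rrcPulse β T t = ∫ f : ℝ, Complex.exp (2 * Real.pi * f * t * Complex.I) *
      (Real.sqrt (raisedCosineSpectrum β T f) : ℝ) := by
  rw [rrcPulse, Real.fourierInv_eq']
  refine integral_congr_ae (ae_of_all _ fun f => ?_)
  simp only [smul_eq_mul, RCLike.inner_apply, conj_trivial]
  congr 2
  push_cast
  ring

lemma norm_exp_two_pi_mul_I (x y : ℝ) :
    ‖Complex.exp (2 * Real.pi * x * y * Complex.I)‖ = 1 := by
  have : (2 * Real.pi * x * y * Complex.I : ℂ) = ((2 * Real.pi * x * y : ℝ) : ℂ) * Complex.I := by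
    push_cast; ring
  rw [this, Complex.norm_exp_ofReal_mul_I]

lemma integrable_rrcPulse_integrand {β T : ℝ} (hβ₀ : 0 ≤ β) (hβ₁ : β ≤ 1) (hT : 0 < T) (t : ℝ) :
    Integrable (fun f : ℝ => Complex.exp (2 * Real.pi * f * t * Complex.I) *
      (Real.sqrt (raisedCosineSpectrum β T f) : ℝ)) := by
  refine (integrable_sqrt_raisedCosineSpectrum hβ₀ hβ₁ hT).ofReal.bdd_mul (c := 1)
    (by fun_prop) (ae_of_all _ fun f => ?_)
  rw [norm_exp_two_pi_mul_I]

lemma continuous_rrcPulse {β T : ℝ} (hβ₀ : 0 ≤ β) (hβ₁ : β ≤ 1) (hT : 0 < T) :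
    Continuous (rrcPulse β T) := by
  simp_rw [funext (rrcPulse_eq_integral β T)]
  refine continuous_of_dominated
    (fun t => (integrable_rrcPulse_integrand hβ₀ hβ₁ hT t).aestronglyMeasurable)
    (fun t => ae_of_all _ fun f => ?_) (integrable_sqrt_raisedCosineSpectrum hβ₀ hβ₁ hT)
    (ae_of_all _ fun f => by fun_prop)
  rw [norm_mul, norm_exp_two_pi_mul_I, one_mul, Complex.norm_real,
    Real.norm_of_nonneg (Real.sqrt_nonneg _)]

/-- The pulse is real because its spectrum is real and even. -/
lemma rrcPulse_im (β T t : ℝ) : (rrcPulse β T t).im = 0 := by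
  rw [← Complex.conj_eq_iff_im, rrcPulse_eq_integral, ← integral_conj,
    ← integral_neg_eq_self]
  refine integral_congr_ae (ae_of_all _ fun f => ?_)
  simp only [map_mul, Complex.conj_ofReal, ← Complex.exp_conj, raisedCosineSpectrum_neg]
  congr 2
  simp [Complex.conj_ofNat]

lemma rrcPulse_zero_re_pos {β T : ℝ} (hβ₀ : 0 ≤ β) (hβ₁ : β ≤ 1) (hT : 0 < T) :
    0 < (rrcPulse β T 0).re := by
  have h : rrcPulse β T 0 = ((∫ f, Real.sqrt (raisedCosineSpectrum β T f) : ℝ) : ℂ) := by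
    rw [rrcPulse_eq_integral]
    simp [integral_complex_ofReal]
  rw [h, Complex.ofReal_re, integral_pos_iff_support_of_nonneg (fun _ => Real.sqrt_nonneg _)
    (integrable_sqrt_raisedCosineSpectrum hβ₀ hβ₁ hT)]
  have hsub : Set.Ioo (-(1 / (2 * T))) (1 / (2 * T)) ⊆
      Function.support fun f => Real.sqrt (raisedCosineSpectrum β T f) := fun f hf =>
    (Real.sqrt_pos.2 (raisedCosineSpectrum_pos hβ₀ hT (abs_lt.2 hf))).ne'
  refine lt_of_lt_of_le ?_ (measure_mono hsub)
  have : 0 < 1 / (2 * T) := by positivity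
  simpa [Real.volume_Ioo] using hT

/-- Bessel's inequality for the integrals of a square-integrable `g` over an interval of length `L`
against the frequencies `t - m / L`: these are Fourier coefficients, up to the factor `L`. -/
lemma summable_sq_norm_integral_exp {a b : ℝ} (hab : a < b) {g : ℝ → ℂ}
    (hg : MemLp g 2 (volume.restrict (Set.Ioc a b))) (t : ℝ) :
    Summable fun m : ℤ => ‖∫ f in a..b,
      Complex.exp (2 * Real.pi * f * ((t - m / (b - a) : ℝ) : ℂ) * Complex.I) * g f‖ ^ 2 := by
  have hba : (b - a : ℂ) ≠ 0 := by exact_mod_cast (sub_pos.2 hab).ne'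
  have hh : MemLp (fun f : ℝ => Complex.exp (2 * Real.pi * f * t * Complex.I) * g f) 2
      (volume.restrict (Set.Ioc a b)) := by
    refine hg.of_le ((Continuous.aestronglyMeasurable (by fun_prop)).mul hg.1)
      (ae_of_all _ fun f => ?_)
    rw [norm_mul, norm_exp_two_pi_mul_I, one_mul]
  refine ((hasSum_sq_fourierCoeffOn hab hh).summable.mul_left ((b - a) ^ 2)).congr fun m => ?_
  rw [fourierCoeffOn_eq_integral, norm_smul, mul_pow, Real.norm_eq_abs, sq_abs, ← mul_assoc,
    ← mul_pow, mul_one_div_cancel (sub_pos.2 hab).ne', one_pow, one_mul]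
  congr 2
  refine intervalIntegral.integral_congr fun f _ => ?_
  simp only [smul_eq_mul]
  rw [fourier_coe_apply, ← mul_assoc, ← Complex.exp_add]
  congr 2
  push_cast
  field_simp
  ring

/-- The band of the pulse lies in `[-1/T, 1/T]`, which two intervals of length `1/τ ≥ 1/T` cover,
so the samples of the pulse at spacing `τ` are sums of two square-summable sequences. -/
lemma summable_sq_rrcPulse {β T : ℝ} (hβ₀ : 0 ≤ β) (hβ₁ : β ≤ 1) (hT : 0 < T) {τ : ℝ}
    (hτ : 0 < τ) (hτT : τ ≤ T) (t : ℝ) :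
    Summable fun m : ℤ => ‖rrcPulse β T (t - m * τ)‖ ^ 2 := by
  set g : ℝ → ℂ := fun f => (Real.sqrt (raisedCosineSpectrum β T f) : ℝ) 
  have hτ' : 0 < 1 / τ := by positivity
  have hg : ∀ a b : ℝ, MemLp g 2 (volume.restrict (Set.Ioc a b)) := fun a b =>
    MemLp.of_bound
      (Complex.measurable_ofReal.comp
        (measurable_raisedCosineSpectrum β T).sqrt).aestronglyMeasurable (Real.sqrt T)
      (ae_of_all _ fun f => by
        rw [Complex.norm_real, Real.norm_of_nonneg (Real.sqrt_nonneg _)]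
        exact Real.sqrt_le_sqrt (raisedCosineSpectrum_le β hT f))
  have h₁ := summable_sq_norm_integral_exp (neg_lt_zero.2 hτ') (hg _ _) t
  have h₂ := summable_sq_norm_integral_exp hτ' (hg _ _) t
  refine Summable.of_nonneg_of_le (fun m => by positivity) (fun m => ?_)
    ((h₁.add h₂).mul_left 2)
  have hsplit : rrcPulse β T (t - m * τ) =
      (∫ f in (-(1 / τ))..0,
        Complex.exp (2 * Real.pi * f * ((t - m / (0 - -(1 / τ)) : ℝ) : ℂ) * Complex.I) * g f) +
      ∫ f in (0 : ℝ)..(1 / τ),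
        Complex.exp (2 * Real.pi * f * ((t - m / (1 / τ - 0) : ℝ) : ℂ) * Complex.I) * g f := by
    have hs : (t - m / (0 - -(1 / τ)) : ℝ) = t - m * τ := by field_simp; ring
    have hs' : (t - m / (1 / τ - 0) : ℝ) = t - m * τ := by field_simp; ring
    have hint := integrable_rrcPulse_integrand hβ₀ hβ₁ hT (t - m * τ)
    rw [hs, hs', intervalIntegral.integral_add_adjacent_intervals hint.intervalIntegrable
      hint.intervalIntegrable, rrcPulse_eq_integral,
      intervalIntegral.integral_of_le (by linarith), ← integral_Icc_eq_integral_Ioc,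
      setIntegral_eq_integral_of_forall_compl_eq_zero]
    intro f hf
    rw [sqrt_raisedCosineSpectrum_eq_zero hβ₀ hβ₁ hT
      (one_div_le_one_div_of_le hτ hτT) f hf, Complex.ofReal_zero, mul_zero]
  rw [hsplit]
  exact (pow_le_pow_left₀ (norm_nonneg _) (norm_add_le _ _) 2).trans add_sq_le

/-! ### Almost sure convergence of random series -/

/-- Kolmogorov's one-series theorem: the partial sums are an `L²`-bounded martingale. -/
lemma ae_exists_tendsto_sum_of_summable_variance {Ω : Type*} [MeasurableSpace Ω] {μ : Measure Ω}
    [IsProbabilityMeasure μ] {Y : ℕ → Ω → ℝ} (hmeas : ∀ n, Measurable (Y n))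
    (hind : iIndepFun Y μ) (hL2 : ∀ n, MemLp (Y n) 2 μ) (hmean : ∀ n, μ[Y n] = 0)
    (hvar : Summable fun n => variance (Y n) μ) :
    ∀ᵐ ω ∂μ, ∃ l, Tendsto (fun N => ∑ n ∈ Finset.range N, Y n ω) atTop (𝓝 l) := by
  have hsm : ∀ n, StronglyMeasurable (Y n) := fun n => (hmeas n).stronglyMeasurable
  set ℱ := Filtration.natural Y hsm
  -- The sums are indexed by `range (N + 1)` so that they are adapted to the natural filtration.
  set S : ℕ → Ω → ℝ := fun N => ∑ n ∈ Finset.range (N + 1), Y n with hS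
  have hSL2 : ∀ N, MemLp (S N) 2 μ := fun N => memLp_finsetSum' _ fun n _ => hL2 n
  have hadp : StronglyAdapted ℱ S := fun N =>
    Finset.stronglyMeasurable_sum _ fun n hn =>
      ((Filtration.stronglyAdapted_natural hsm) n).mono
        (ℱ.mono (Nat.lt_succ_iff.1 (Finset.mem_range.1 hn)))
  have hmart : Martingale S ℱ μ := by
    refine martingale_of_condExp_sub_eq_zero_nat hadp
      (fun N => (hSL2 N).integrable one_le_two) fun N => ?_
    have hdiff : S (N + 1) - S N = Y (N + 1) := by
      simp [hS, Finset.sum_range_succ _ (N + 1)]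
    rw [hdiff]
    filter_upwards [hind.condExp_natural_ae_eq_of_lt hsm (Nat.lt_succ_self N)] with ω hω
    rw [hω, hmean, Pi.zero_apply]
  have hSvar : ∀ N, variance (S N) μ ≤ ∑' n, variance (Y n) μ := fun N => by
    rw [hS, IndepFun.variance_sum (fun n _ => hL2 n) fun i _ j _ hij => hind.indepFun hij]
    exact hvar.sum_le_tsum _ fun n _ => variance_nonneg _ _
  have hSmean : ∀ N, μ[S N] = 0 := fun N => by
    simp only [hS, Finset.sum_apply]
    rw [integral_finsetSum _ fun n _ => (hL2 n).integrable one_le_two]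
    exact Finset.sum_eq_zero fun n _ => hmean n
  have hbdd : ∀ N, eLpNorm (S N) 1 μ ≤
      ((1 + ∑' n, variance (Y n) μ).toNNReal : ENNReal) := fun N => by
    have hi := (hSL2 N).integrable one_le_two
    rw [eLpNorm_one_eq_lintegral_enorm, ← ofReal_integral_norm_eq_lintegral_enorm hi]
    refine ENNReal.ofReal_le_ofReal ?_
    calc ∫ ω, ‖S N ω‖ ∂μ ≤ ∫ ω, (1 + S N ω ^ 2) ∂μ := by
          refine integral_mono hi.norm ((integrable_const 1).add (hSL2 N).integrable_sq)
            fun ω => ?_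
          simp only [Real.norm_eq_abs]
          nlinarith [sq_abs (S N ω), sq_nonneg (|S N ω| - 1), abs_nonneg (S N ω)]
      _ = 1 + variance (S N) μ := by
          rw [integral_add (integrable_const 1) (hSL2 N).integrable_sq,
            variance_of_integral_eq_zero (hSL2 N).1.aemeasurable (hSmean N)]
          simp
      _ ≤ _ := by gcongr; exact hSvar N
  filter_upwards [hmart.submartingale.ae_tendsto_limitProcess hbdd] with ω hω
  refine ⟨_, (tendsto_add_atTop_iff_nat 1).1 (hω.congr fun N => ?_)⟩
  simp [hS]

lemma sum_Icc_neg_eq_sum_range (f : ℤ → ℝ) (M : ℕ) :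
    ∑ m ∈ Finset.Icc (-(M : ℤ)) M, f m =
      ∑ n ∈ Finset.range (M + 1), f n + ∑ n ∈ Finset.range M, f (-((n : ℤ) + 1)) := by
  induction M with
  | zero => simp
  | succ M ih =>
    have h : Finset.Icc (-((M + 1 : ℕ) : ℤ)) ((M + 1 : ℕ) : ℤ) =
        insert (-((M : ℤ) + 1)) (insert ((M : ℤ) + 1) (Finset.Icc (-(M : ℤ)) M)) := by
      ext x
      simp only [Finset.mem_Icc, Finset.mem_insert]
      push_cast
      omega
    rw [h, Finset.sum_insert, Finset.sum_insert, ih, Finset.sum_range_succ _ (M + 1),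
      Finset.sum_range_succ (fun n : ℕ => f (-((n : ℤ) + 1))) M]
    · push_cast; ring
    · simp
    · simp; omega

/-- The two-sided version of the one-series theorem, for symmetric partial sums. -/
lemma ae_exists_tendsto_sum_Icc_of_summable_variance {Ω : Type*} [MeasurableSpace Ω]
    {μ : Measure Ω} [IsProbabilityMeasure μ] {Y : ℤ → Ω → ℝ} (hmeas : ∀ n, Measurable (Y n))
    (hind : iIndepFun Y μ) (hL2 : ∀ n, MemLp (Y n) 2 μ) (hmean : ∀ n, μ[Y n] = 0)
    (hvar : Summable fun n => variance (Y n) μ) :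
    ∀ᵐ ω ∂μ, ∃ l, Tendsto (fun M : ℕ => ∑ m ∈ Finset.Icc (-(M : ℤ)) M, Y m ω) atTop (𝓝 l) := by
  have hpos : Function.Injective (fun n : ℕ => (n : ℤ)) := Nat.cast_injective
  have hneg : Function.Injective (fun n : ℕ => -((n : ℤ) + 1)) := fun i j h => by
    simpa using h
  filter_upwards [
    ae_exists_tendsto_sum_of_summable_variance (fun n => hmeas _) (hind.precomp hpos)
      (fun n => hL2 _) (fun n => hmean _) (hvar.comp_injective hpos),
    ae_exists_tendsto_sum_of_summable_variance (fun n => hmeas _) (hind.precomp hneg)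
      (fun n => hL2 _) (fun n => hmean _) (hvar.comp_injective hneg)] with ω ⟨l₁, h₁⟩ ⟨l₂, h₂⟩
  refine ⟨l₁ + l₂, (((tendsto_add_atTop_iff_nat 1).2 h₁).add h₂).congr fun M => ?_⟩
  exact (sum_Icc_neg_eq_sum_range (fun m => Y m ω) M).symm

/-! ### Small-ball estimates -/

/-- A Gaussian small-ball functional is the Gaussian average of the characteristic function. -/
lemma integral_exp_neg_sq_le_integral_norm_charFun (ν : Measure ℝ) [IsProbabilityMeasure ν] :
    ∫ x, Real.exp (-x ^ 2 / 2) ∂ν ≤ ∫ ξ, ‖charFun ν ξ‖ ∂gaussianReal 0 1 := by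
  have hswap : ∫ ξ, charFun ν ξ ∂gaussianReal 0 1 = ∫ x, charFun (gaussianReal 0 1) x ∂ν := by
    simp_rw [charFun_apply_real]
    rw [integral_integral_swap]
    · refine integral_congr_ae (ae_of_all _ fun x => integral_congr_ae (ae_of_all _ fun ξ => ?_))
      simp only [mul_comm (ξ : ℂ)]
    · refine Integrable.of_bound (C := 1) (Continuous.aestronglyMeasurable (by fun_prop))
        (ae_of_all _ fun z => ?_)
      simp only [Function.uncurry]
      rw [← Complex.ofReal_mul, Complex.norm_exp_ofReal_mul_I]
  have hreal : ∫ x, charFun (gaussianReal 0 1) x ∂ν =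
      ((∫ x, Real.exp (-x ^ 2 / 2) ∂ν : ℝ) : ℂ) := by
    rw [← integral_complex_ofReal]
    refine integral_congr_ae (ae_of_all _ fun x => ?_)
    simp only [charFun_gaussianReal]
    push_cast
    congr 1
    simp
    ring
  calc ∫ x, Real.exp (-x ^ 2 / 2) ∂ν ≤ ‖((∫ x, Real.exp (-x ^ 2 / 2) ∂ν : ℝ) : ℂ)‖ := by
        rw [Complex.norm_real]; exact le_abs_self _
    _ = ‖∫ ξ, charFun ν ξ ∂gaussianReal 0 1‖ := by rw [hswap, hreal]
    _ ≤ _ := norm_integral_le_integral_norm _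

/-- Markov's inequality for `exp (-X² / 2)`. -/
lemma measureReal_sq_lt_le {Ω : Type*} [MeasurableSpace Ω] {μ : Measure Ω}
    [IsProbabilityMeasure μ] {X : Ω → ℝ} (hX : AEMeasurable X μ) (γ : ℝ) :
    μ.real {ω | X ω ^ 2 < γ} ≤ Real.exp (γ / 2) * ∫ ω, Real.exp (-X ω ^ 2 / 2) ∂μ := by
  have hint : Integrable (fun ω => Real.exp (-X ω ^ 2 / 2)) μ :=
    Integrable.of_bound (C := 1) (by fun_prop) (ae_of_all _ fun ω => by
      rw [Real.norm_of_nonneg (Real.exp_pos _).le, Real.exp_le_one_iff]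
      nlinarith [sq_nonneg (X ω)])
  have h := mul_meas_ge_le_integral_of_nonneg (ae_of_all _ fun ω => (Real.exp_pos _).le) hint
    (Real.exp (-γ / 2))
  calc μ.real {ω | X ω ^ 2 < γ}
      = Real.exp (γ / 2) * (Real.exp (-γ / 2) * μ.real {ω | X ω ^ 2 < γ}) := by
        rw [← mul_assoc, ← Real.exp_add]; ring_nf; simp
    _ ≤ Real.exp (γ / 2) * (Real.exp (-γ / 2) *
          μ.real {ω | Real.exp (-γ / 2) ≤ Real.exp (-X ω ^ 2 / 2)}) := by
        refine mul_le_mul_of_nonneg_left (mul_le_mul_of_nonneg_left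
          (measureReal_mono fun ω hω => ?_) (Real.exp_pos _).le) (Real.exp_pos _).le
        simp only [Set.mem_ofPred_eq] at hω ⊢
        rw [Real.exp_le_exp]
        linarith
    _ ≤ _ := by gcongr

/-- The characteristic function of `A` times a random sign. -/
lemma charFun_half_dirac (A ξ : ℝ) :
    charFun ((2⁻¹ : ENNReal) • Measure.dirac A + (2⁻¹ : ENNReal) • Measure.dirac (-A)) ξ =
      Real.cos (A * ξ) := by
  rw [charFun_apply_real, integral_add_measure, integral_smul_measure, integral_smul_measure,
    integral_dirac, integral_dirac, Complex.ofReal_cos, Complex.cos]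
  · simp only [ENNReal.toReal_inv, ENNReal.toReal_ofNat, Complex.real_smul]
    push_cast
    ring_nf
  all_goals
    exact (integrable_dirac (by simp)).smul_measure (by simp)

/-- The Gaussian average of `∏ |cos (A vⱼ ξ)|`, which bounds the small-ball functional of
`∑ ± A vⱼ`. -/
noncomputable def cosAverage (A : ℝ) {n : ℕ} (v : Fin n → ℝ) : ℝ :=
  ∫ ξ, ∏ j, |Real.cos (A * v j * ξ)| ∂gaussianReal 0 1

lemma continuous_cosAverage (A : ℝ) (n : ℕ) :
    Continuous (cosAverage A : (Fin n → ℝ) → ℝ) := by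
  refine continuous_of_dominated (bound := fun _ => 1)
    (fun v => Continuous.aestronglyMeasurable (by fun_prop))
    (fun v => ae_of_all _ fun ξ => ?_) (integrable_const 1) (ae_of_all _ fun ξ => by fun_prop)
  rw [Real.norm_of_nonneg (Finset.prod_nonneg fun _ _ => abs_nonneg _)]
  exact Finset.prod_le_one (fun _ _ => abs_nonneg _) fun _ _ => Real.abs_cos_le_one _

/-- For equal nonzero weights the average tends to zero, since `|cos| < 1` almost everywhere. -/
lemma tendsto_cosAverage_const {A w : ℝ} (hA : A ≠ 0) (hw : w ≠ 0) :
    Tendsto (fun n => cosAverage A (fun _ : Fin n => w)) atTop (𝓝 0) := by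
  have hAw : A * w ≠ 0 := mul_ne_zero hA hw
  have hlim : ∀ᵐ ξ ∂gaussianReal 0 1,
      Tendsto (fun n : ℕ => ∏ _j : Fin n, |Real.cos (A * w * ξ)|) atTop (𝓝 0) := by
    have hcount : (Set.range fun k : ℤ => (k * Real.pi) / (A * w)).Countable :=
      Set.countable_range _
    have : NullSingletonClass (gaussianReal 0 1) := nullSingletonClass_gaussianReal one_ne_zero
    filter_upwards [hcount.ae_notMem (gaussianReal 0 1)] with ξ hξ
    simp only [Finset.prod_const, Finset.card_univ, Fintype.card_fin]
    refine tendsto_pow_atTop_nhds_zero_of_lt_one (abs_nonneg _)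
      (lt_of_le_of_ne (Real.abs_cos_le_one _) fun h => hξ ?_)
    have hsin : Real.sin (A * w * ξ) = 0 := by
      have := Real.sin_sq_add_cos_sq (A * w * ξ)
      rw [← sq_abs (Real.cos _), h] at this
      nlinarith
    obtain ⟨k, hk⟩ := Real.sin_eq_zero_iff.1 hsin
    exact ⟨k, by simp only [hk]; field_simp⟩
  have := tendsto_integral_of_dominated_convergence (fun _ => (1 : ℝ))
    (fun n => Continuous.aestronglyMeasurable (by fun_prop)) (integrable_const 1)
    (fun n => ae_of_all _ fun ξ => ?_) hlim
  · simpa [cosAverage] using this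
  · rw [Real.norm_of_nonneg (Finset.prod_nonneg fun _ _ => abs_nonneg _)]
    exact Finset.prod_le_one (fun _ _ => abs_nonneg _) fun _ _ => Real.abs_cos_le_one _

/-- Small-ball bound for a weighted sum of independent random signs; any subfamily of the weights
controls the whole sum. -/
lemma integral_exp_neg_sq_sum_le_cosAverage {Ω ι : Type*} [MeasurableSpace Ω] {μ : Measure Ω}
    [IsProbabilityMeasure μ] {b : ι → Ω → ℝ} {A : ℝ} (hmeas : ∀ i, Measurable (b i))
    (hind : iIndepFun b μ)
    (hlaw : ∀ i, μ.map (b i) =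
      (2⁻¹ : ENNReal) • Measure.dirac A + (2⁻¹ : ENNReal) • Measure.dirac (-A))
    (s : Finset ι) (v : ι → ℝ) {n : ℕ} {e : Fin n → ι} (he : Function.Injective e)
    (hes : ∀ j, e j ∈ s) :
    ∫ ω, Real.exp (-(∑ i ∈ s, b i ω * v i) ^ 2 / 2) ∂μ ≤ cosAverage A fun j => v (e j) := by
  classical
  have hmeas' : ∀ i, Measurable fun ω => b i ω * v i := fun i => (hmeas i).mul_const _
  have hsum : Measurable fun ω => ∑ i ∈ s, b i ω * v i :=
    Finset.measurable_fun_sum _ fun i _ => hmeas' i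
  have hind' : iIndepFun (fun i ω => b i ω * v i) μ :=
    hind.comp (fun i x => x * v i) fun i => measurable_id.mul_const _
  have : IsProbabilityMeasure (μ.map fun ω => ∑ i ∈ s, b i ω * v i) :=
    Measure.isProbabilityMeasure_map hsum.aemeasurable
  have hchar : ∀ ξ, charFun (μ.map fun ω => ∑ i ∈ s, b i ω * v i) ξ =
      ∏ i ∈ s, (Real.cos (A * v i * ξ) : ℂ) := fun ξ => by
    rw [iIndepFun.charFun_map_fun_finsetSum_eq_prod (fun i _ => (hmeas' i).aemeasurable)
      (hind'.restrict s), Finset.prod_apply]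
    refine Finset.prod_congr rfl fun i _ => ?_
    simp_rw [mul_comm _ (v i)]
    rw [charFun_map_mul_comp (hmeas i).aemeasurable, hlaw, charFun_half_dirac]
    ring_nf
  calc ∫ ω, Real.exp (-(∑ i ∈ s, b i ω * v i) ^ 2 / 2) ∂μ
      = ∫ x, Real.exp (-x ^ 2 / 2) ∂(μ.map fun ω => ∑ i ∈ s, b i ω * v i) := by
        rw [integral_map hsum.aemeasurable (Continuous.aestronglyMeasurable (by fun_prop))]
    _ ≤ _ := integral_exp_neg_sq_le_integral_norm_charFun _
    _ ≤ _ := by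
        refine integral_mono ?_ ?_ fun ξ => ?_
        · refine Integrable.of_bound (C := 1) (by fun_prop) (ae_of_all _ fun ξ => ?_)
          rw [norm_norm]
          exact norm_charFun_le_one _
        · refine Integrable.of_bound (C := 1) (Continuous.aestronglyMeasurable (by fun_prop))
            (ae_of_all _ fun ξ => ?_)
          rw [Real.norm_of_nonneg (Finset.prod_nonneg fun _ _ => abs_nonneg _)]
          exact Finset.prod_le_one (fun _ _ => abs_nonneg _) fun _ _ => Real.abs_cos_le_one _
        · simp only [hchar, norm_prod, Complex.norm_real, Real.norm_eq_abs]
          rw [← Finset.prod_image (s := Finset.univ) (g := e)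
            (f := fun i => |Real.cos (A * v i * ξ)|) he.injOn]
          refine Finset.prod_le_prod_of_subset_of_le_one ?_ ?_ ?_
          · intro i hi
            obtain ⟨j, -, rfl⟩ := Finset.mem_image.1 hi
            exact hes j
          · exact fun _ _ => abs_nonneg _
          · exact fun _ _ _ => Real.abs_cos_le_one _

/-! ### Random signs -/

section RandomSign

variable {Ω : Type*} [MeasurableSpace Ω] {μ : Measure Ω} {b : Ω → ℝ} {A : ℝ}

lemma ae_abs_eq_of_map_eq_half_dirac (hb : Measurable b) (hlaw : μ.map b =
      (2⁻¹ : ENNReal) • Measure.dirac A + (2⁻¹ : ENNReal) • Measure.dirac (-A)) :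
    ∀ᵐ ω ∂μ, |b ω| = |A| := by
  refine ae_of_ae_map (p := fun x => |x| = |A|) hb.aemeasurable ?_
  rw [hlaw, ae_add_measure_iff]
  constructor
  · exact Measure.ae_smul_measure (by simp [ae_dirac_eq]) _
  · exact Measure.ae_smul_measure (by simp [ae_dirac_eq]) _

lemma integral_eq_zero_of_map_eq_half_dirac (hb : Measurable b) (hlaw : μ.map b =
      (2⁻¹ : ENNReal) • Measure.dirac A + (2⁻¹ : ENNReal) • Measure.dirac (-A)) :
    μ[b] = 0 := by
  have h : ∫ x, x ∂(μ.map b) = μ[b] :=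
    integral_map hb.aemeasurable (f := fun x => x) (by fun_prop)
  rw [← h, hlaw, integral_add_measure, integral_smul_measure, integral_smul_measure,
    integral_dirac, integral_dirac]
  · simp
  all_goals
    exact (integrable_dirac (by simp)).smul_measure (by simp)

end RandomSign

/-- A series of independent random signs with square-summable weights converges almost surely. -/
lemma ae_exists_tendsto_sum_sign_mul {Ω : Type*} [MeasurableSpace Ω] {μ : Measure Ω}
    [IsProbabilityMeasure μ] {b : ℤ → Ω → ℝ} {A : ℝ} (hmeas : ∀ m, Measurable (b m))
    (hind : iIndepFun b μ)
    (hlaw : ∀ m, μ.map (b m) =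
      (2⁻¹ : ENNReal) • Measure.dirac A + (2⁻¹ : ENNReal) • Measure.dirac (-A))
    {v : ℤ → ℝ} (hv : Summable fun m => v m ^ 2) :
    ∀ᵐ ω ∂μ, ∃ l,
      Tendsto (fun M : ℕ => ∑ m ∈ Finset.Icc (-(M : ℤ)) M, b m ω * v m) atTop (𝓝 l) := by
  have hmeas' : ∀ m, Measurable fun ω => b m ω * v m := fun m => (hmeas m).mul_const _
  have habs : ∀ m, ∀ᵐ ω ∂μ, |b m ω * v m| = |A| * |v m| := fun m => by
    filter_upwards [ae_abs_eq_of_map_eq_half_dirac (hmeas m) (hlaw m)] with ω hω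
    rw [abs_mul, hω]
  have hL2 : ∀ m, MemLp (fun ω => b m ω * v m) 2 μ := fun m =>
    MemLp.of_bound (hmeas' m).aestronglyMeasurable (|A| * |v m|)
      ((habs m).mono fun ω hω => hω.le)
  refine ae_exists_tendsto_sum_Icc_of_summable_variance hmeas'
    (hind.comp (fun m x => x * v m) fun m => measurable_id.mul_const _) hL2 (fun m => ?_) ?_
  · rw [integral_mul_const, integral_eq_zero_of_map_eq_half_dirac (hmeas m) (hlaw m), zero_mul]
  · refine Summable.of_nonneg_of_le (fun m => variance_nonneg _ _) (fun m => ?_)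
      (hv.mul_left (A ^ 2))
    refine (variance_le_expectation_sq (hmeas' m).aestronglyMeasurable).trans_eq ?_
    have : ∀ᵐ ω ∂μ, ((fun ω => b m ω * v m) ^ 2) ω = A ^ 2 * v m ^ 2 := by
      filter_upwards [habs m] with ω hω
      rw [Pi.pow_apply, ← sq_abs, hω, mul_pow, sq_abs, sq_abs]
    rw [integral_congr_ae this]
    simp

/-! ### The faster-than-Nyquist signal -/

lemma re_ftnSignal {Ω : Type*} {p : ℝ → ℂ} {a : ℤ → Ω → ℂ} {τ : ℝ} (hp : ∀ s, (p s).im = 0)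
    (M : ℕ) (t : ℝ) (ω : Ω) :
    (ftnSignal p a τ M t ω).re =
      ∑ m ∈ Finset.Icc (-(M : ℤ)) M, (a m ω).re * (p (t - m * τ)).re := by
  simp [ftnSignal, Complex.re_sum, hp]

lemma im_ftnSignal {Ω : Type*} {p : ℝ → ℂ} {a : ℤ → Ω → ℂ} {τ : ℝ} (hp : ∀ s, (p s).im = 0)
    (M : ℕ) (t : ℝ) (ω : Ω) :
    (ftnSignal p a τ M t ω).im =
      ∑ m ∈ Finset.Icc (-(M : ℤ)) M, (a m ω).im * (p (t - m * τ)).re := by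
  simp [ftnSignal, Complex.im_sum, hp]

section Signal

variable {Ω : Type*} [MeasurableSpace Ω] {μ : Measure Ω} {p : ℝ → ℂ} {a : ℤ → Ω → ℂ} {E τ : ℝ}

lemma IsIIDQPSK.iIndepFun_re (ha : IsIIDQPSK μ a E) : iIndepFun (fun m ω => (a m ω).re) μ :=
  ha.iIndep.comp (fun _ z => z.re) fun _ => Complex.measurable_re

lemma IsIIDQPSK.iIndepFun_im (ha : IsIIDQPSK μ a E) : iIndepFun (fun m ω => (a m ω).im) μ :=
  ha.iIndep.comp (fun _ z => z.im) fun _ => Complex.measurable_im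

lemma measurable_ftnSignal_uncurry (hpc : Continuous p) (ha : ∀ m, Measurable (a m)) (M : ℕ) :
    Measurable fun z : ℝ × Ω => ftnSignal p a τ M z.1 z.2 := by
  unfold ftnSignal
  refine Finset.measurable_fun_sum _ fun m _ => ?_
  exact ((ha m).comp measurable_snd).mul (hpc.measurable.comp (by fun_prop))

lemma measurable_ftnSignalInf_uncurry (hpc : Continuous p) (ha : ∀ m, Measurable (a m)) :
    Measurable fun z : ℝ × Ω => ftnSignalInf p a τ z.1 z.2 :=
  (StronglyMeasurable.limUnder fun M =>
    (measurable_ftnSignal_uncurry hpc ha M).stronglyMeasurable).measurable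

variable [IsProbabilityMeasure μ]

lemma ae_tendsto_ftnSignalInf (ha : IsIIDQPSK μ a E) (hp : ∀ s, (p s).im = 0) (t : ℝ)
    (hsum : Summable fun m : ℤ => ‖p (t - m * τ)‖ ^ 2) :
    ∀ᵐ ω ∂μ, Tendsto (fun M : ℕ => ftnSignal p a τ M t ω) atTop
      (𝓝 (ftnSignalInf p a τ t ω)) := by
  have hsum' : Summable fun m : ℤ => (p (t - m * τ)).re ^ 2 := by
    refine hsum.congr fun m => ?_
    rw [Complex.sq_norm, Complex.normSq_apply, hp]
    ring
  filter_upwards [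
    ae_exists_tendsto_sum_sign_mul (fun m => Complex.measurable_re.comp (ha.measurable m))
      ha.iIndepFun_re ha.map_re hsum',
    ae_exists_tendsto_sum_sign_mul (fun m => Complex.measurable_im.comp (ha.measurable m))
      ha.iIndepFun_im ha.map_im hsum'] with ω ⟨l₁, h₁⟩ ⟨l₂, h₂⟩
  refine tendsto_nhds_limUnder ⟨(l₁ : ℂ) + l₂ * Complex.I, ?_⟩
  refine (((Complex.continuous_ofReal.tendsto _).comp h₁).add
    (((Complex.continuous_ofReal.tendsto _).comp h₂).mul_const Complex.I)).congr fun M => ?_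
  rw [Function.comp_apply, Function.comp_apply, ← Complex.re_add_im (ftnSignal p a τ M t ω),
    re_ftnSignal hp, im_ftnSignal hp]
  rfl

lemma integral_exp_neg_sq_re_ftnSignal_le (ha : IsIIDQPSK μ a E) (hp : ∀ s, (p s).im = 0)
    {n M : ℕ} (hnM : n ≤ M) (t : ℝ) :
    ∫ ω, Real.exp (-(ftnSignal p a τ M t ω).re ^ 2 / 2) ∂μ ≤
      cosAverage (Real.sqrt (E / 2)) fun j : Fin n => (p (t - (j : ℕ) * τ)).re := by
  simp_rw [re_ftnSignal hp]
  have h := integral_exp_neg_sq_sum_le_cosAverage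
    (fun m => Complex.measurable_re.comp (ha.measurable m)) ha.iIndepFun_re ha.map_re
    (Finset.Icc (-(M : ℤ)) M) (fun m => (p (t - m * τ)).re)
    (e := fun j : Fin n => ((j : ℕ) : ℤ)) (fun i j h => Fin.ext (by simpa using h))
    (fun j => by have := j.2; simp only [Finset.mem_Icc]; omega)
  simpa using h

/-- The bound for finitely many symbols passes to the limit by dominated convergence. -/
lemma integral_exp_neg_sq_re_ftnSignalInf_le (ha : IsIIDQPSK μ a E) (hp : ∀ s, (p s).im = 0)
    (n : ℕ) (t : ℝ) (hsum : Summable fun m : ℤ => ‖p (t - m * τ)‖ ^ 2) :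
    ∫ ω, Real.exp (-(ftnSignalInf p a τ t ω).re ^ 2 / 2) ∂μ ≤
      cosAverage (Real.sqrt (E / 2)) fun j : Fin n => (p (t - (j : ℕ) * τ)).re := by
  have hmeas : ∀ M, Measurable (ftnSignal p a τ M t) := fun M => by
    unfold ftnSignal
    exact Finset.measurable_fun_sum _ fun m _ => (ha.measurable m).mul_const _
  have hlim : Tendsto (fun M => ∫ ω, Real.exp (-(ftnSignal p a τ M t ω).re ^ 2 / 2) ∂μ) atTop
      (𝓝 (∫ ω, Real.exp (-(ftnSignalInf p a τ t ω).re ^ 2 / 2) ∂μ)) := by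
    refine tendsto_integral_of_dominated_convergence (fun _ => 1) (fun M => ?_)
      (integrable_const 1) (fun M => ae_of_all _ fun ω => ?_) ?_
    · have := hmeas M
      exact Measurable.aestronglyMeasurable (by fun_prop)
    · rw [Real.norm_of_nonneg (Real.exp_pos _).le, Real.exp_le_one_iff]
      nlinarith [sq_nonneg (ftnSignal p a τ M t ω).re]
    · filter_upwards [ae_tendsto_ftnSignalInf ha hp t hsum] with ω hω
      exact ((by fun_prop : Continuous fun z : ℂ => Real.exp (-z.re ^ 2 / 2)).tendsto _).comp hω
  refine le_of_tendsto hlim ?_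
  filter_upwards [eventually_ge_atTop n] with M hM
  exact integral_exp_neg_sq_re_ftnSignal_le ha hp hM t

end Signal

/-- As `τ → 0` the first `n` pulses all reach the height `p 0` near `t ∈ [0, τ]`, so the average
is close to the one for `n` equal weights, which is small for `n` large. -/
lemma exists_cosAverage_lt {p : ℝ → ℂ} (hpc : Continuous p) (hp₀ : (p 0).re ≠ 0) {A : ℝ}
    (hA : A ≠ 0) {ε : ℝ} (hε : 0 < ε) :
    ∃ n : ℕ, ∃ η > 0, ∀ t τ : ℝ, 0 ≤ t → t ≤ τ → τ < η →
      cosAverage A (fun j : Fin n => (p (t - (j : ℕ) * τ)).re) < ε := by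
  obtain ⟨n, hn⟩ := ((tendsto_cosAverage_const hA hp₀).eventually_lt_const hε).exists
  have hcont : Continuous fun z : ℝ × ℝ =>
      cosAverage A (fun j : Fin n => (p (z.1 - (j : ℕ) * z.2)).re) :=
    (continuous_cosAverage A n).comp (by fun_prop)
  have hnhds : ∀ᶠ z : ℝ × ℝ in 𝓝 0,
      cosAverage A (fun j : Fin n => (p (z.1 - (j : ℕ) * z.2)).re) < ε :=
    (hcont.tendsto 0).eventually_lt_const (by simpa using hn)
  obtain ⟨η, hη, h⟩ := Metric.eventually_nhds_iff.1 hnhds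
  refine ⟨n, η, hη, fun t τ ht htτ hτη => h (y := (t, τ)) ?_⟩
  rw [dist_zero_right, Prod.norm_def, max_lt_iff, Real.norm_of_nonneg ht,
    Real.norm_of_nonneg (ht.trans htτ)]
  exact ⟨htτ.trans_lt hτη, hτη⟩

/-- A small-ball bound on the real part that is uniform over one period controls the averaged CCDF.
Joint measurability makes the CCDF integrable in `t`, so that its average is not a junk value. -/
lemma abs_avgPowerCCDF_sub_one_le {Ω : Type*} [MeasurableSpace Ω] {μ : Measure Ω}
    [IsProbabilityMeasure μ] {x : ℝ → Ω → ℂ} (hx : Measurable fun z : ℝ × Ω => x z.1 z.2)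
    {τ : ℝ} (hτ : 0 < τ) (γ : ℝ) {K : ℝ}
    (hK : ∀ t, 0 ≤ t → t ≤ τ → ∫ ω, Real.exp (-(x t ω).re ^ 2 / 2) ∂μ ≤ K) :
    |avgPowerCCDF μ x τ γ - 1| ≤ Real.exp (γ / 2) * K := by
  have hxt : ∀ t, Measurable (x t) := fun t => hx.comp (by fun_prop : Measurable fun ω => (t, ω))
  have hmeas : Measurable (powerCCDF μ x γ) := by
    have hset : MeasurableSet {z : ℝ × Ω | γ ≤ ‖x z.1 z.2‖ ^ 2} :=
      measurableSet_le measurable_const (hx.norm.pow_const 2)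
    exact (measurable_measure_prodMk_left (ν := μ) hset).ennreal_toReal
  have hle : ∀ t, powerCCDF μ x γ t ≤ 1 := fun t => measureReal_le_one
  have hge : ∀ t, 0 ≤ t → t ≤ τ → 1 - Real.exp (γ / 2) * K ≤ powerCCDF μ x γ t := by
    intro t ht htτ
    have hset : MeasurableSet {ω | γ ≤ ‖x t ω‖ ^ 2} :=
      measurableSet_le measurable_const ((hxt t).norm.pow_const 2)
    have hcompl : μ.real {ω | γ ≤ ‖x t ω‖ ^ 2}ᶜ ≤ μ.real {ω | (x t ω).re ^ 2 < γ} := by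
      refine measureReal_mono fun ω hω => ?_
      simp only [Set.mem_compl_iff, Set.mem_ofPred_eq, not_le] at hω ⊢
      refine lt_of_le_of_lt ?_ hω
      rw [Complex.sq_norm, Complex.normSq_apply]
      nlinarith [mul_self_nonneg (x t ω).im]
    have hmarkov := measureReal_sq_lt_le (μ := μ) (X := fun ω => (x t ω).re)
      (Complex.measurable_re.comp (hxt t)).aemeasurable γ
    have hbound := mul_le_mul_of_nonneg_left (hK t ht htτ) (Real.exp_pos (γ / 2)).le
    rw [probReal_compl_eq_one_sub hset] at hcompl
    unfold powerCCDF
    linarith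
  have hint : IntervalIntegrable (powerCCDF μ x γ) volume 0 τ := by
    rw [intervalIntegrable_iff_integrableOn_Ioc_of_le hτ.le]
    refine Measure.integrableOn_of_bounded (M := 1) (by simp) hmeas.aestronglyMeasurable
      (ae_of_all _ fun t => ?_)
    exact (Real.norm_of_nonneg measureReal_nonneg).trans_le (hle t)
  have hupper : ∫ t in (0 : ℝ)..τ, powerCCDF μ x γ t ≤ τ := by
    simpa using intervalIntegral.integral_mono_on hτ.le hint
      (intervalIntegrable_const (c := (1 : ℝ))) fun t _ => hle t
  have hlower : τ * (1 - Real.exp (γ / 2) * K) ≤ ∫ t in (0 : ℝ)..τ, powerCCDF μ x γ t := by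
    have h := intervalIntegral.integral_mono_on hτ.le
      (intervalIntegrable_const (c := 1 - Real.exp (γ / 2) * K)) hint
      fun t ht => hge t ht.1 ht.2
    rwa [intervalIntegral.integral_const, sub_zero, smul_eq_mul] at h
  have hK₀ : 0 ≤ Real.exp (γ / 2) * K := by linarith [hge 0 le_rfl hτ.le, hle 0]
  have hdiv : avgPowerCCDF μ x τ γ * τ = ∫ t in (0 : ℝ)..τ, powerCCDF μ x γ t := by
    rw [avgPowerCCDF]
    field_simp
  rw [abs_le]
  constructor
  · have := le_of_mul_le_mul_right (a := τ) (b := 1 - Real.exp (γ / 2) * K)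
      (c := avgPowerCCDF μ x τ γ) (by linarith) hτ
    linarith
  · have := le_of_mul_le_mul_right (a := τ) (b := avgPowerCCDF μ x τ γ) (c := 1)
      (by linarith) hτ
    linarith

theorem theorem4 {Ω : Type*} [MeasurableSpace Ω] (μ : Measure Ω) [IsProbabilityMeasure μ]
    -- RRC pulse of roll-off factor `β` for the symbol period `T`
    (β T : ℝ) (hβ₀ : 0 ≤ β) (hβ₁ : β ≤ 1) (hT : 0 < T)
    -- transmit power `P δ` of the antenna: the product `P δ * δ` does not depend on `δ`
    (P : ℝ → ℝ) (c : ℝ) (hc : 0 < c) (hP : ∀ δ : ℝ, 0 < δ → δ ≤ 1 → P δ * δ = c)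
    -- i.i.d. QPSK symbols `a δ m` of energy `P δ * δ * T`
    (a : ℝ → ℤ → Ω → ℂ)
    (ha : ∀ δ : ℝ, 0 < δ → δ ≤ 1 → IsIIDQPSK μ (a δ) (P δ * δ * T)) :
    -- `2 M + 1` symbols, with `M → ∞` and `δ → 0` independently of each other
    (∀ γ : ℝ, Tendsto
      (fun q : ℕ × ℝ =>
        avgPowerCCDF μ (ftnSignal (rrcPulse β T) (a q.2) (q.2 * T) q.1) (q.2 * T) γ)
      (atTop ×ˢ 𝓝[>] (0 : ℝ)) (𝓝 1)) ∧
    -- the unlimited symbol stream: the signal exists almost surely at every time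
    (∀ δ : ℝ, 0 < δ → δ ≤ 1 → ∀ t : ℝ, ∀ᵐ ω ∂μ, Tendsto
      (fun M : ℕ => ftnSignal (rrcPulse β T) (a δ) (δ * T) M t ω) atTop
      (𝓝 (ftnSignalInf (rrcPulse β T) (a δ) (δ * T) t ω))) ∧
    (∀ γ : ℝ, Tendsto
      (fun δ : ℝ => avgPowerCCDF μ (ftnSignalInf (rrcPulse β T) (a δ) (δ * T)) (δ * T) γ)
      (𝓝[>] (0 : ℝ)) (𝓝 1)) := by
  have hpc := continuous_rrcPulse hβ₀ hβ₁ hT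
  have hp := rrcPulse_im β T
  have hA : Real.sqrt (c * T / 2) ≠ 0 := (Real.sqrt_pos.2 (by positivity)).ne'
  have ha' : ∀ δ : ℝ, 0 < δ → δ ≤ 1 → IsIIDQPSK μ (a δ) (c * T) := fun δ hδ hδ₁ =>
    hP δ hδ hδ₁ ▸ ha δ hδ hδ₁
  have hsum : ∀ δ : ℝ, 0 < δ → δ ≤ 1 → ∀ t : ℝ,
      Summable fun m : ℤ => ‖rrcPulse β T (t - m * (δ * T))‖ ^ 2 := fun δ hδ hδ₁ t =>
    summable_sq_rrcPulse hβ₀ hβ₁ hT (by positivity) (mul_le_of_le_one_left hT.le hδ₁) t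
  -- The tolerance is chosen so that the factor `exp (γ / 2)` of Markov's inequality cancels.
  have hsmall : ∀ γ ε : ℝ, 0 < ε → ∃ n : ℕ, ∀ᶠ δ in 𝓝[>] (0 : ℝ), 0 < δ ∧ δ ≤ 1 ∧
      ∀ t, 0 ≤ t → t ≤ δ * T → cosAverage (Real.sqrt (c * T / 2))
        (fun j : Fin n => (rrcPulse β T (t - (j : ℕ) * (δ * T))).re) ≤
          Real.exp (-γ / 2) * (ε / 2) := by
    intro γ ε hε
    obtain ⟨n, η, hη, h⟩ := exists_cosAverage_lt hpc (rrcPulse_zero_re_pos hβ₀ hβ₁ hT).ne' hA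
      (by positivity : 0 < Real.exp (-γ / 2) * (ε / 2))
    refine ⟨n, ?_⟩
    filter_upwards [Ioo_mem_nhdsGT (by positivity : 0 < min 1 (η / T))] with δ hδ
    refine ⟨hδ.1, hδ.2.le.trans (min_le_left _ _), fun t ht htδ => (h t _ ht htδ ?_).le⟩
    exact (lt_div_iff₀ hT).1 (hδ.2.trans_le (min_le_right _ _))
  have hcancel : ∀ γ ε : ℝ, 0 < ε → Real.exp (γ / 2) * (Real.exp (-γ / 2) * (ε / 2)) < ε := by
    intro γ ε hε
    rw [← mul_assoc, ← Real.exp_add, show γ / 2 + -γ / 2 = 0 by ring, Real.exp_zero]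
    linarith
  refine ⟨fun γ => ?_, fun δ hδ hδ₁ t => ?_, fun γ => ?_⟩
  · refine Metric.tendsto_nhds.2 fun ε hε => ?_
    obtain ⟨n, hn⟩ := hsmall γ ε hε
    filter_upwards [(eventually_ge_atTop n).prod_mk hn] with q hq
    obtain ⟨hM, hδ, hδ₁, h⟩ := hq
    rw [Real.dist_eq]
    refine (abs_avgPowerCCDF_sub_one_le
      (measurable_ftnSignal_uncurry hpc (ha' _ hδ hδ₁).measurable _) (by positivity) γ
      fun t ht htδ => ?_).trans_lt (hcancel γ ε hε)
    exact (integral_exp_neg_sq_re_ftnSignal_le (ha' _ hδ hδ₁) hp hM t).trans (h t ht htδ)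
  · exact ae_tendsto_ftnSignalInf (ha' δ hδ hδ₁) hp t (hsum δ hδ hδ₁ t)
  · refine Metric.tendsto_nhds.2 fun ε hε => ?_
    obtain ⟨n, hn⟩ := hsmall γ ε hε
    filter_upwards [hn] with δ hq
    obtain ⟨hδ, hδ₁, h⟩ := hq
    rw [Real.dist_eq]
    refine (abs_avgPowerCCDF_sub_one_le
      (measurable_ftnSignalInf_uncurry hpc (ha' _ hδ hδ₁).measurable) (by positivity) γ
      fun t ht htδ => ?_).trans_lt (hcancel γ ε hε)
    exact (integral_exp_neg_sq_re_ftnSignalInf_le (ha' _ hδ hδ₁) hp n t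
      (hsum δ hδ hδ₁ t)).trans (h t ht htδ)
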